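/- All graphs are simple. An edge colouring (not necessarily proper) of a graph $G$ is distinguishing if the only automorphism of $G$ preserving the colour of every edge is the identity. The distinguishing index $D'(G)$ is the least number of colours in a distinguishing edge colouring of $G$ (and $D'(G)=\infty$ if no finite number of colours suffices). Let $\Delta\ge 0$ be an integer and let $G$ be a connected $\Delta$-regular graph, finite or infinite. (a) If $\Delta\neq 1$, then $D'(G)\le 3$. (b) If $G\not\cong K_2$, then $G$ has a distinguishing edge colouring with the three colours red, green and blue such that there is at most one vertex all of whose incident edges are coloured blue; moreover, if $G$ is a complete graph with more than one vertex, then the colouring can be chosen so that there is no such vertex. -/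

import Mathlib

namespace SimpleGraph

/-- An edge colouring (not necessarily proper) of `G` is distinguishing if the only automorphism
of `G` that preserves the colour of every edge is the identity. -/
def IsDistinguishing {V C : Type*} {G : SimpleGraph V} (c : G.EdgeLabeling C) : Prop :=
  ∀ φ : G ≃g G, (∀ e : G.edgeSet, c (φ.mapEdgeSet e) = c e) → φ = Iso.refl

/-- The distinguishing index of `G`: the least number `k` of colours such that `G` has a
distinguishing edge colouring with `k` colours, and `⊤` if no finite number of colours suffices. -/
noncomputable def distinguishingIndex {V : Type*} (G : SimpleGraph V) : ℕ∞ :=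
  sInf {k : ℕ∞ | ∃ n : ℕ, k = n ∧ ∃ c : G.EdgeLabeling (Fin n), IsDistinguishing c}

/-- The three colours red, green and blue. -/
inductive RGB : Type
  | red
  | green
  | blue

/-- All edges incident to `v` are coloured blue by `c`. -/
def IsAllBlue {V : Type*} {G : SimpleGraph V} (c : G.EdgeLabeling RGB) (v : V) : Prop :=
  ∀ e : G.edgeSet, v ∈ (e : Sym2 V) → c e = RGB.blue

end SimpleGraph

/-! ### Sums of balanced list colourings -/

namespace SimpleGraph

/-! For `Δ ≤ 1` the graph is a single vertex or `K₂`, so let `Δ ≥ 2`. Number the colours 0, 1, 2,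
with blue as 2, and let the weight of a vertex be the sum of the colours at it. A root `r` gets
weight `ρ = Δ / 2 + 2 * (Δ % 2)`. All other vertices avoid `ρ`, so `r` is fixed, and every vertex
avoids `2 * Δ`, so none is all blue.

Suppose that the vertices of a set `F` are known to be fixed. The vertices outside `F` that are
joined to `F` by the same edges in the same colours form a class, which every colour preserving
automorphism maps to itself. Colouring the free edges of its members so that their weights are
distinct fixes them too (`IsPartial.exists_union`, `Fixes.union`), and Zorn's lemma exhausts the
graph.

Distinct weights need room. `exists_sums_of_balanced` offers a vertex with `f` neighbours outside
`F` at least `f + 1` weights, and does so by colourings that split each class of these neighbours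
roughly in half. The halving preserves the bound `small` on class sizes (`IsPartial.exists_insert`),
and that bound keeps the number of weights to be avoided at most `f`. -/

open scoped Pointwise in
/-- If `N` is partitioned by `κ`, and each element of `N` has a list of at least two of the colours
`0, 1, 2` (all three, if it is not alone in its class), then at least `#N + 1` values are sums of
colourings from the lists which use each colour on at most half of each class, rounded up. -/
theorem exists_sums_of_balanced {α β : Type*} [DecidableEq α] [DecidableEq β] (κ : α → β)
    (L : α → Finset ℕ) (N : Finset α) (hL2 : ∀ y ∈ N, 2 ≤ (L y).card)
    (hL3 : ∀ y ∈ N, ∀ z ∈ N, y ≠ z → κ y = κ z → L y = Finset.range 3) :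
    ∃ Y : Finset ℕ, N.card + 1 ≤ Y.card ∧ ∀ s ∈ Y, ∃ h : α → ℕ, (∀ y ∈ N, h y ∈ L y) ∧
      ∑ y ∈ N, h y = s ∧ ∀ b k, 2 * (N.filter fun y => κ y = b ∧ h y = k).card ≤
        (N.filter fun y => κ y = b).card + 1 := by
  induction hn : N.card using Nat.strong_induction_on generalizing N with
  | _ n ih =>
  subst hn
  by_cases hpair : ∃ y ∈ N, ∃ z ∈ N, y ≠ z ∧ κ y = κ z
  · obtain ⟨y, hy, z, hz, hyz, hκ⟩ := hpair
    obtain ⟨M, hyM, hzM, rfl⟩ : ∃ M : Finset α, y ∉ M ∧ z ∉ M ∧ N = insert y (insert z M) := by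
      refine ⟨(N.erase y).erase z, by simp, by simp, ?_⟩
      rw [Finset.insert_erase (by simp [hz, hyz.symm]), Finset.insert_erase hy]
    have hyM' : y ∉ insert z M := by simp [hyz, hyM]
    have hcard : (insert y (insert z M)).card = M.card + 2 := by
      rw [Finset.card_insert_of_notMem hyM', Finset.card_insert_of_notMem hzM]
    have hLy : L y = Finset.range 3 := hL3 y hy z hz hyz hκ
    have hLz : L z = Finset.range 3 := hL3 z hz y hy hyz.symm hκ.symm
    obtain ⟨Y, hY, hYh⟩ := ih M.card (by omega) M (fun x hx => hL2 x (by simp [hx]))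
      (fun x hx x' hx' => hL3 x (by simp [hx]) x' (by simp [hx'])) rfl
    -- Two distinct colours have sum 1, 2 or 3. So the pair adds two new sums, while each colour
    -- occurs at most once on it.
    refine ⟨Y + {1, 2, 3}, ?_, ?_⟩
    · have := cauchy_davenport_add_of_linearOrder_isCancelAdd (s := Y) (t := {1, 2, 3})
        (Finset.card_pos.1 (by omega)) (by simp)
      have h3 : ({1, 2, 3} : Finset ℕ).card = 3 := rfl
      omega
    · intro s hs
      obtain ⟨t, ht, p, hp, rfl⟩ := Finset.mem_add.1 hs
      obtain ⟨h, hhL, hsum, hbal⟩ := hYh t ht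
      obtain ⟨i, j, hi, hj, hij, rfl⟩ : ∃ i j : ℕ, i < 3 ∧ j < 3 ∧ i ≠ j ∧ i + j = p := by
        simp only [Finset.mem_insert, Finset.mem_singleton] at hp
        rcases hp with rfl | rfl | rfl
        · exact ⟨0, 1, by simp⟩
        · exact ⟨0, 2, by simp⟩
        · exact ⟨1, 2, by simp⟩
      have hne : ∀ x ∈ M, x ≠ y ∧ x ≠ z := fun x hx =>
        ⟨fun e => hyM (e ▸ hx), fun e => hzM (e ▸ hx)⟩
      let h' : α → ℕ := fun x => if x = y then i else if x = z then j else h x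
      have h'y : h' y = i := by simp [h']
      have h'z : h' z = j := by simp [h', hyz.symm]
      have h'M : ∀ x ∈ M, h' x = h x := fun x hx => by simp [h', hne x hx]
      refine ⟨h', ?_, ?_, ?_⟩
      · intro x hx
        rcases Finset.mem_insert.1 hx with rfl | hx
        · rw [h'y, hLy]; simpa using hi
        rcases Finset.mem_insert.1 hx with rfl | hx
        · rw [h'z, hLz]; simpa using hj
        · rw [h'M x hx]; exact hhL x hx
      · rw [Finset.sum_insert hyM', Finset.sum_insert hzM, h'y, h'z, Finset.sum_congr rfl h'M, hsum]
        omega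
      · intro b k
        have e : (M.filter fun x => κ x = b ∧ h' x = k) = M.filter fun x => κ x = b ∧ h x = k :=
          Finset.filter_congr fun x hx => by rw [h'M x hx]
        have hb := hbal b k
        rw [Finset.filter_insert, Finset.filter_insert, Finset.filter_insert, Finset.filter_insert,
          h'y, h'z, e, ← hκ]
        by_cases hb' : κ y = b
        · have hz' : z ∉ M.filter fun x => κ x = b := by simp [hzM]
          have hy' : y ∉ insert z (M.filter fun x => κ x = b) := by simp [hyM, hyz]
          simp only [hb', true_and, if_true]
          rw [Finset.card_insert_of_notMem hy', Finset.card_insert_of_notMem hz']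
          by_cases hik : i = k
          · have hjk : j ≠ k := fun e => hij (hik.trans e.symm)
            simp only [hik, hjk, if_true, if_false]
            have := Finset.card_insert_le y (M.filter fun x => κ x = b ∧ h x = k)
            omega
          · simp only [hik, if_false]
            split_ifs
            · have := Finset.card_insert_le z (M.filter fun x => κ x = b ∧ h x = k)
              omega
            · omega
        · simpa [hb'] using hb
  · push Not at hpair
    rcases N.eq_empty_or_nonempty with rfl | ⟨y, hy⟩
    · exact ⟨{0}, by simp, fun s hs => ⟨fun _ => 0, by simp_all⟩⟩
    obtain ⟨M, hyM, rfl⟩ : ∃ M : Finset α, y ∉ M ∧ N = insert y M :=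
      ⟨N.erase y, by simp, (Finset.insert_erase hy).symm⟩
    have hcard := Finset.card_insert_of_notMem hyM
    obtain ⟨Y, hY, hYh⟩ := ih M.card (by omega) M (fun x hx => hL2 x (by simp [hx]))
      (fun x hx x' hx' => hL3 x (by simp [hx]) x' (by simp [hx'])) rfl
    have hy2 := hL2 y hy
    -- All classes are now singletons, so balance is automatic, and a list of two colours already
    -- adds one new sum.
    refine ⟨Y + L y, ?_, ?_⟩
    · have := cauchy_davenport_add_of_linearOrder_isCancelAdd (s := Y) (t := L y)
        (Finset.card_pos.1 (by omega)) (Finset.card_pos.1 (by omega))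
      omega
    · intro s hs
      obtain ⟨t, ht, p, hp, rfl⟩ := Finset.mem_add.1 hs
      obtain ⟨h, hhL, hsum, -⟩ := hYh t ht
      have hne : ∀ x ∈ M, x ≠ y := fun x hx e => hyM (e ▸ hx)
      let h' : α → ℕ := fun x => if x = y then p else h x
      have h'y : h' y = p := by simp [h']
      have h'M : ∀ x ∈ M, h' x = h x := fun x hx => by simp [h', hne x hx]
      refine ⟨h', ?_, ?_, ?_⟩
      · intro x hx
        rcases Finset.mem_insert.1 hx with rfl | hx
        · rwa [h'y]
        · rw [h'M x hx]; exact hhL x hx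
      · rw [Finset.sum_insert hyM, h'y, Finset.sum_congr rfl h'M, hsum, add_comm]
      · intro b k
        have h1 : ((insert y M).filter fun x => κ x = b).card ≤ 1 := by
          refine Finset.card_le_one.2 fun u hu v hv => ?_
          rw [Finset.mem_filter] at hu hv
          by_contra huv
          exact hpair u hu.1 v hv.1 huv (hu.2.trans hv.2.symm)
        have h2 : ((insert y M).filter fun x => κ x = b ∧ h' x = k).card ≤
            ((insert y M).filter fun x => κ x = b).card :=
          Finset.card_le_card fun x => by simp +contextual
        omega

end SimpleGraph

/-! ### Partial colourings and their extension at one vertex -/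

namespace SimpleGraph

open scoped Classical in
/-- The edges from `v` to the vertices of `N` may be recoloured at will. -/
theorem exists_recolour {V : Type*} (c : Sym2 V → ℕ) (v : V) (N : Finset V) (h : V → ℕ) :
    ∃ c' : Sym2 V → ℕ, (∀ y ∈ N, c' s(v, y) = h y) ∧
      ∀ e, (∀ y ∈ N, e ≠ s(v, y)) → c' e = c e := by
  refine ⟨fun e => if H : ∃ y ∈ N, e = s(v, y) then h H.choose else c e, ?_, ?_⟩
  · intro y hy
    have H : ∃ z ∈ N, s(v, y) = s(v, z) := ⟨y, hy, rfl⟩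
    refine (dif_pos H).trans ?_
    rw [← Sym2.congr_right.1 H.choose_spec.2]
  · intro e he
    exact dif_neg fun ⟨y, hy, e'⟩ => he y hy e'

section

variable {V : Type*} (G : SimpleGraph V)

open scoped Classical in
/-- The colours of the edges from the vertices of `F` to `y`. -/
noncomputable def trace (F : Set V) (c : Sym2 V → ℕ) (y : V) : V → Option ℕ := fun w =>
  if w ∈ F ∧ G.Adj w y then some (c s(w, y)) else none

/-- The two colourings agree on the edges that meet `F`. -/
def AgreeOn (F : Set V) (c c' : Sym2 V → ℕ) : Prop := ∀ w ∈ F, ∀ x, c' s(w, x) = c s(w, x)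

variable {G}

theorem trace_eq_iff {F : Set V} {c : Sym2 V → ℕ} {x y : V} :
    G.trace F c y = G.trace F c x ↔
      ∀ w ∈ F, (G.Adj w y ↔ G.Adj w x) ∧ (G.Adj w x → c s(w, y) = c s(w, x)) := by
  constructor
  · intro h w hw
    have := congrFun h w
    simp only [trace, hw, true_and] at this
    by_cases h1 : G.Adj w y <;> by_cases h2 : G.Adj w x <;> simp_all
  · intro h
    ext1 w
    by_cases hw : w ∈ F
    · have := h w hw
      by_cases h2 : G.Adj w x <;> simp_all [trace]
    · simp [trace, hw]

theorem AgreeOn.trans {F F' : Set V} {c c' c'' : Sym2 V → ℕ} (h : AgreeOn F c c')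
    (h' : AgreeOn F' c' c'') (hF : F ⊆ F') : AgreeOn F c c'' := fun w hw x => by
  rw [h' w (hF hw), h w hw]

theorem AgreeOn.trace_eq {F : Set V} {c c' : Sym2 V → ℕ} (h : AgreeOn F c c') (x : V) :
    G.trace F c' x = G.trace F c x := by
  ext1 w
  simp only [trace]
  split_ifs with hw
  · rw [h w hw.1]
  · rfl

end

section

variable {V : Type*} (G : SimpleGraph V) [G.LocallyFinite]

/-- The sum of the colours of the edges at `v`. -/
def weight (c : Sym2 V → ℕ) (v : V) : ℕ := ∑ x ∈ G.neighborFinset v, c s(v, x)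

open scoped Classical in
/-- The neighbours of `v` in `F`. -/
noncomputable def nbrsIn (F : Set V) (v : V) : Finset V := {x ∈ G.neighborFinset v | x ∈ F}

open scoped Classical in
/-- The neighbours of `v` outside `F`. -/
noncomputable def nbrsOut (F : Set V) (v : V) : Finset V := {x ∈ G.neighborFinset v | x ∉ F}

/-- `c` uses the colours `0`, `1`, `2`, and the classes of vertices outside `F` that send the
same colours to `F` are small; every vertex other than `r` whose edges all meet `F` has a weight
different from `ρ` and `2 * Δ`. -/
structure IsPartial (Δ ρ : ℕ) (r : V) (F : Set V) (c : Sym2 V → ℕ) : Prop where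
  root_mem : r ∈ F
  le_two : ∀ e, c e ≤ 2
  small : ∀ A : Finset V, ∀ x ∈ A, (∀ y ∈ A, y ∉ F ∧ G.trace F c y = G.trace F c x) →
    (G.nbrsIn F x).Nonempty → A.card ≤ 1 ∨ 2 * A.card + (G.nbrsIn F x).card ≤ Δ + 1
  weight_ne : ∀ u, u ≠ r → (u ∈ F ∨ ∀ z, G.Adj u z → z ∈ F) →
    G.weight c u ≠ ρ ∧ G.weight c u ≠ 2 * Δ

variable {G}

@[simp] theorem mem_nbrsIn {F : Set V} {v x : V} : x ∈ G.nbrsIn F v ↔ G.Adj v x ∧ x ∈ F := by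
  simp [nbrsIn]

@[simp] theorem mem_nbrsOut {F : Set V} {v x : V} : x ∈ G.nbrsOut F v ↔ G.Adj v x ∧ x ∉ F := by
  simp [nbrsOut]

theorem AgreeOn.weight_eq {F : Set V} {c c' : Sym2 V → ℕ} (h : AgreeOn F c c') {v : V}
    (hv : v ∈ F ∨ ∀ z, G.Adj v z → z ∈ F) : G.weight c' v = G.weight c v := by
  refine Finset.sum_congr rfl fun x hx => ?_
  rw [mem_neighborFinset] at hx
  rcases hv with hv | hv
  · exact h v hv x
  · rw [Sym2.eq_swap]; exact h x (hv x hx) v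

theorem card_nbrsIn_add_card_nbrsOut (F : Set V) (v : V) :
    (G.nbrsIn F v).card + (G.nbrsOut F v).card = G.degree v := by
  classical
  exact Finset.card_filter_add_card_filter_not _

theorem weight_eq_add (F : Set V) (c : Sym2 V → ℕ) (v : V) :
    G.weight c v = ∑ x ∈ G.nbrsIn F v, c s(v, x) + ∑ x ∈ G.nbrsOut F v, c s(v, x) := by
  classical
  exact (Finset.sum_filter_add_sum_filter_not _ _ _).symm

theorem card_nbrsIn_congr {F : Set V} {c : Sym2 V → ℕ} {x y : V}
    (h : G.trace F c y = G.trace F c x) : G.nbrsIn F y = G.nbrsIn F x := by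
  ext w
  simp only [mem_nbrsIn, and_congr_left_iff]
  intro hw
  simpa [G.adj_comm] using (trace_eq_iff.1 h w hw).1

/-- The colours which an edge `uv` may get when all other edges at `u` are coloured with sum `S`
and the weights `ρ` and `2 * Δ` are forbidden for `u`. -/
def allowedColours (Δ ρ S : ℕ) : Finset ℕ := {k ∈ Finset.range 3 | S + k ≠ ρ ∧ S + k ≠ 2 * Δ}

/-- Only one colour can be lost: `2 * Δ` is within reach only if `S = 2 * Δ - 2`, and then `ρ < S`.
-/
theorem two_le_card_allowedColours {Δ S : ℕ} (hΔ : 2 ≤ Δ) (hS : S ≤ 2 * (Δ - 1)) :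
    2 ≤ (allowedColours Δ (Δ / 2 + 2 * (Δ % 2)) S).card := by
  obtain ⟨i, hi⟩ : ∃ i, Finset.range 3 \ {i} ⊆ allowedColours Δ (Δ / 2 + 2 * (Δ % 2)) S := by
    by_cases h : S + 2 = 2 * Δ
    · refine ⟨2, fun k hk => ?_⟩
      simp only [allowedColours, Finset.mem_filter, Finset.mem_sdiff, Finset.mem_range,
        Finset.mem_singleton] at hk ⊢
      omega
    · refine ⟨Δ / 2 + 2 * (Δ % 2) - S, fun k hk => ?_⟩
      simp only [allowedColours, Finset.mem_filter, Finset.mem_sdiff, Finset.mem_range,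
        Finset.mem_singleton] at hk ⊢
      omega
  have h1 := Finset.card_le_card hi
  have h2 := Finset.le_card_sdiff {i} (Finset.range 3)
  simp only [Finset.card_range, Finset.card_singleton] at h2
  omega

/-- All edges from a vertex `v` adjacent to `F` can be coloured so that the weight of `v` avoids
as many values as `v` has neighbours outside `F`. -/
theorem IsPartial.exists_insert {Δ : ℕ} (hΔ : 2 ≤ Δ) (hreg : G.IsRegularOfDegree Δ) {r : V}
    {F : Set V} {c : Sym2 V → ℕ} (hc : G.IsPartial Δ (Δ / 2 + 2 * (Δ % 2)) r F c) {v : V}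
    (hv : v ∉ F) (hvF : (G.nbrsIn F v).Nonempty) (X : Finset ℕ)
    (hX : X.card ≤ (G.nbrsOut F v).card) :
    ∃ c' : Sym2 V → ℕ, AgreeOn F c c' ∧ (∀ e, c' e ≤ 2) ∧ G.weight c' v ∉ X ∧
      (G.weight c' v ≠ Δ / 2 + 2 * (Δ % 2) → G.weight c' v ≠ 2 * Δ →
        G.IsPartial Δ (Δ / 2 + 2 * (Δ % 2)) r (insert v F) c') := by
  classical
  set ρ := Δ / 2 + 2 * (Δ % 2) with hρ
  set N := G.nbrsOut F v with hN
  have hNv : ∀ y ∈ N, y ≠ v := fun y hy e => by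
    subst e; simp [hN] at hy
  -- If `vy` is the last uncoloured edge at `y`, it settles the weight of `y`, so the forbidden
  -- weights restrict its colour.
  let L : V → Finset ℕ := fun y =>
    if ∀ z, G.Adj y z → z ∈ insert v F then allowedColours Δ ρ (∑ x ∈ G.nbrsIn F y, c s(y, x))
    else Finset.range 3
  -- the neighbours of `y` in `insert v F`
  have hins : ∀ y ∈ N, G.nbrsIn (insert v F) y = insert v (G.nbrsIn F y) ∧ v ∉ G.nbrsIn F y := by
    intro y hy
    have hy' := (mem_nbrsOut.1 hy).1.symm
    refine ⟨?_, by simp [hv]⟩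
    ext z
    simp only [mem_nbrsIn, Set.mem_insert_iff, Finset.mem_insert]
    constructor
    · rintro ⟨h1, rfl | h2⟩
      · exact Or.inl rfl
      · exact Or.inr ⟨h1, h2⟩
    · rintro (rfl | ⟨h1, h2⟩)
      · exact ⟨hy', Or.inl rfl⟩
      · exact ⟨h1, Or.inr h2⟩
  have hcrit : ∀ y ∈ N, (∀ z, G.Adj y z → z ∈ insert v F) → (G.nbrsIn F y).card = Δ - 1 := by
    intro y hy h
    have h1 := hins y hy
    have h2 : G.nbrsIn (insert v F) y = G.neighborFinset y := by
      ext z; simpa using h z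
    have h3 := hreg y
    rw [← card_neighborFinset_eq_degree, ← h2, h1.1, Finset.card_insert_of_notMem h1.2] at h3
    omega
  have hL2 : ∀ y ∈ N, 2 ≤ (L y).card := by
    intro y hy
    simp only [L]
    split_ifs with h
    · refine two_le_card_allowedColours hΔ ?_
      have := Finset.sum_le_card_nsmul (G.nbrsIn F y) (fun x => c s(y, x)) 2
        fun x _ => hc.le_two _
      rw [hcrit y hy h] at this
      simpa [mul_comm] using this
    · simp
  have hL3 : ∀ y ∈ N, ∀ z ∈ N, y ≠ z → G.trace F c y = G.trace F c z → L y = Finset.range 3 := by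
    intro y hy z hz hyz ht
    simp only [L]
    split_ifs with h
    · exfalso
      have h1 := hcrit y hy h
      rw [card_nbrsIn_congr ht] at h1
      have h2 := hc.small {y, z} z (by simp) (by
        intro x hx
        simp only [Finset.mem_insert, Finset.mem_singleton] at hx
        rcases hx with rfl | rfl
        · exact ⟨(mem_nbrsOut.1 hy).2, ht⟩
        · exact ⟨(mem_nbrsOut.1 hz).2, rfl⟩) (Finset.card_pos.1 (by omega))
      rw [Finset.card_pair hyz] at h2
      omega
    · rfl
  obtain ⟨Y, hY, hYh⟩ := exists_sums_of_balanced (G.trace F c) L N hL2 hL3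
  set S := ∑ x ∈ G.nbrsIn F v, c s(v, x) with hS
  obtain ⟨s, hsY, hsX⟩ : ∃ s ∈ Y, S + s ∉ X := by
    by_contra! H
    have := Finset.card_le_card_of_injOn (s := Y) (t := X) (fun s => S + s) H
      fun a _ b _ e => Nat.add_left_cancel e
    omega
  obtain ⟨h, hhL, hsum, hbal⟩ := hYh s hsY
  obtain ⟨c', hc'N, hc'⟩ := exists_recolour c v N h
  have hagree : AgreeOn F c c' := by
    intro w hw x
    refine hc' _ fun y hy e => ?_
    rcases Sym2.eq_iff.1 e with ⟨rfl, -⟩ | ⟨rfl, -⟩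
    · exact hv hw
    · exact (mem_nbrsOut.1 hy).2 hw
  have hagree' : ∀ w x, w ∈ F → c' s(x, w) = c s(x, w) := fun w x hw => by
    rw [Sym2.eq_swap]; exact hagree w hw x
  have hL : ∀ y ∈ N, L y ⊆ Finset.range 3 := by
    intro y hy
    simp only [L]
    split_ifs
    · exact Finset.filter_subset _ _
    · exact subset_rfl
  have hwv : G.weight c' v = S + s := by
    rw [weight_eq_add F, hS, ← hsum, Finset.sum_congr rfl fun x hx => hagree' x v (mem_nbrsIn.1 hx).2,
      Finset.sum_congr rfl hc'N]
  have hle : ∀ e, c' e ≤ 2 := by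
    intro e
    by_cases he : ∃ y ∈ N, e = s(v, y)
    · obtain ⟨y, hy, rfl⟩ := he
      have := Finset.mem_range.1 (hL y hy (hhL y hy))
      rw [hc'N y hy]
      omega
    · push Not at he
      rw [hc' e he]; exact hc.le_two e
  refine ⟨c', hagree, hle, hwv ▸ hsX,
    fun hw1 hw2 => ⟨Set.mem_insert_of_mem _ hc.root_mem, hle, ?_, ?_⟩⟩
  · intro A x hxA hA hxF
    have hA' : ∀ y ∈ A, y ∉ F ∧ y ≠ v ∧ G.trace F c y = G.trace F c x ∧
        (G.Adj v y ↔ G.Adj v x) ∧ (G.Adj v x → c' s(v, y) = c' s(v, x)) := by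
      intro y hy
      obtain ⟨h1, h2⟩ := hA y hy
      rw [trace_eq_iff] at h2
      refine ⟨fun e => h1 (Set.mem_insert_of_mem _ e), fun e => h1 (e ▸ Set.mem_insert _ _), ?_,
        (h2 v (Set.mem_insert _ _)).1, (h2 v (Set.mem_insert _ _)).2⟩
      rw [← hagree.trace_eq, ← hagree.trace_eq, trace_eq_iff]
      exact fun w hw => h2 w (Set.mem_insert_of_mem _ hw)
    by_cases hvx : G.Adj v x
    · have hxN : x ∈ N := mem_nbrsOut.2 ⟨hvx, (hA' x hxA).1⟩
      obtain ⟨hi1, hi2⟩ := hins x hxN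
      rw [hi1, Finset.card_insert_of_notMem hi2]
      set B := N.filter fun y => G.trace F c y = G.trace F c x with hB
      have hAB : 2 * A.card ≤ B.card + 1 := by
        refine le_trans (Nat.mul_le_mul_left 2 (Finset.card_le_card fun y hy => ?_))
          (hbal (G.trace F c x) (h x))
        obtain ⟨h1, h2, h3, h4, h5⟩ := hA' y hy
        have hyN : y ∈ N := mem_nbrsOut.2 ⟨h4.2 hvx, h1⟩
        have := h5 hvx
        rw [hc'N y hyN, hc'N x hxN] at this
        exact Finset.mem_filter.2 ⟨hyN, h3, this⟩
      -- If `B` has at least two elements, halving it pays for the extra neighbour `v`. Without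
      -- neighbours of `x` in `F` there is no earlier bound on `B`, but `B ⊆ N`, and `N` has at most
      -- `Δ - 1` elements because `v` has a neighbour in `F`.
      by_cases hq : (G.nbrsIn F x).Nonempty
      · have := hc.small B x (Finset.mem_filter.2 ⟨hxN, rfl⟩) (fun y hy => by
          rw [hB, Finset.mem_filter] at hy
          exact ⟨(mem_nbrsOut.1 hy.1).2, hy.2⟩) hq
        omega
      · rw [Finset.not_nonempty_iff_eq_empty] at hq
        have h1 : B.card ≤ N.card := Finset.card_le_card (Finset.filter_subset _ _)
        have h2 := card_nbrsIn_add_card_nbrsOut (G := G) F v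
        have h3 := Finset.card_pos.2 hvF
        rw [hreg v, ← hN] at h2
        rw [hq]
        simp only [Finset.card_empty]
        right; omega
    · have hnb : G.nbrsIn (insert v F) x = G.nbrsIn F x := by
        ext z
        simp only [mem_nbrsIn, Set.mem_insert_iff]
        constructor
        · rintro ⟨h1, rfl | h2⟩
          · exact absurd h1.symm hvx
          · exact ⟨h1, h2⟩
        · exact fun h => ⟨h.1, Or.inr h.2⟩
      rw [hnb] at hxF ⊢
      exact hc.small A x hxA (fun y hy => ⟨(hA' y hy).1, (hA' y hy).2.2.1⟩) hxF
  · intro u hur hu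
    by_cases huv : u = v
    · subst huv; exact ⟨hw1, hw2⟩
    by_cases huF : u ∈ F ∨ ∀ z, G.Adj u z → z ∈ F
    · rw [hagree.weight_eq huF]
      exact hc.weight_ne u hur huF
    push Not at huF
    have hu' : ∀ z, G.Adj u z → z ∈ insert v F := by
      rcases hu with hu | hu
      · exact absurd hu (by simp [huv, huF.1])
      · exact hu
    have huN : u ∈ N := by
      obtain ⟨z, hz, hzF⟩ := huF.2
      rcases hu' z hz with rfl | h
      · exact mem_nbrsOut.2 ⟨hz.symm, huF.1⟩
      · exact absurd h hzF
    have h1 := hhL u huN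
    simp only [L] at h1
    rw [if_pos hu'] at h1
    have h2 : G.nbrsOut F u = {v} := by
      ext z
      simp only [mem_nbrsOut, Finset.mem_singleton]
      constructor
      · rintro ⟨h1, h2⟩
        exact (hu' z h1).resolve_right h2
      · rintro rfl
        exact ⟨(mem_nbrsOut.1 huN).1.symm, hv⟩
    rw [weight_eq_add F, h2, Finset.sum_singleton, Sym2.eq_swap (a := u) (b := v), hc'N u huN,
      Finset.sum_congr rfl fun x hx => hagree' x u (mem_nbrsIn.1 hx).2]
    exact (Finset.mem_filter.1 h1).2

end

end SimpleGraph

/-! ### Fixing whole classes, the root, and Zorn's lemma -/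

namespace SimpleGraph

section

variable {V : Type*} {G : SimpleGraph V} [G.LocallyFinite]

/-- The vertices of a class can be coloured one after the other, with pairwise distinct weights. -/
theorem IsPartial.exists_union {Δ : ℕ} (hΔ : 2 ≤ Δ) (hreg : G.IsRegularOfDegree Δ) {r : V}
    {F : Set V} {c : Sym2 V → ℕ} (hc : G.IsPartial Δ (Δ / 2 + 2 * (Δ % 2)) r F c) (C : Finset V)
    (hC : ∀ x ∈ C, ∀ y ∈ C, G.trace F c y = G.trace F c x)
    (hCF : ∀ x ∈ C, x ∉ F ∧ (G.nbrsIn F x).Nonempty) :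
    ∃ c' : Sym2 V → ℕ, AgreeOn F c c' ∧ Set.InjOn (G.weight c') C ∧
      G.IsPartial Δ (Δ / 2 + 2 * (Δ % 2)) r (F ∪ C) c' := by
  classical
  suffices H : ∀ D : Finset V, D ⊆ C → ∃ c' : Sym2 V → ℕ, AgreeOn F c c' ∧
      Set.InjOn (G.weight c') D ∧ G.IsPartial Δ (Δ / 2 + 2 * (Δ % 2)) r (F ∪ D) c' from
    H C subset_rfl
  intro D
  induction D using Finset.induction_on with
  | empty => exact fun _ => ⟨c, fun _ _ _ => rfl, by simp, by simpa using hc⟩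
  | insert v D hvD ih =>
    intro hD
    obtain ⟨c₁, hag, hinj, hc₁⟩ := ih ((Finset.subset_insert v D).trans hD)
    have hvC : v ∈ C := hD (Finset.mem_insert_self v D)
    obtain ⟨hvF, hvn⟩ := hCF v hvC
    set ρ := Δ / 2 + 2 * (Δ % 2) with hρ
    have hv : v ∉ F ∪ (D : Set V) := by simp [hvF, hvD]
    have hsub : G.nbrsIn F v ⊆ G.nbrsIn (F ∪ D) v := fun x hx => by
      simp only [mem_nbrsIn] at hx ⊢; exact ⟨hx.1, Or.inl hx.2⟩
    have hq := card_nbrsIn_add_card_nbrsOut (G := G) (F ∪ D) v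
    rw [hreg v] at hq
    have hq' : (G.nbrsIn (F ∪ D) v).card ≤ (G.nbrsIn F v).card + D.card := by
      refine le_trans (Finset.card_le_card fun x hx => ?_) (Finset.card_union_le _ _)
      simp only [mem_nbrsIn, Finset.mem_union, Set.mem_union, Finset.mem_coe] at hx ⊢
      tauto
    have hq1 := Finset.card_pos.2 (hvn.mono hsub)
    have hq0 := Finset.card_pos.2 hvn
    have hsmall := hc.small C v hvC (fun y hy => ⟨(hCF y hy).1, hC v hvC y hy⟩) hvn
    have hDC : D.card + 1 ≤ C.card := by
      rw [← Finset.card_insert_of_notMem hvD]; exact Finset.card_le_card hD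
    set f := (G.nbrsOut (F ∪ D) v).card with hf
    set S := ∑ x ∈ G.nbrsIn (F ∪ D) v, c₁ s(v, x) with hS
    -- Only forbidden weights within reach count. For `f = 0` the weight is already settled, and
    -- `weight_ne` covers it.
    let E : Finset ℕ := {k ∈ {ρ, 2 * Δ} | S ≤ k ∧ k ≤ S + 2 * f ∧ 0 < f}
    have hX : (D.image (G.weight c₁) ∪ E).card ≤ f := by
      have h1 := Finset.card_union_le (D.image (G.weight c₁)) E
      have h2 : (D.image (G.weight c₁)).card ≤ D.card := Finset.card_image_le
      have hE0 : f = 0 → E.card = 0 := by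
        intro h0
        simp [E, h0]
      have hE2 : E.card ≤ 2 :=
        (Finset.card_filter_le _ _).trans (Finset.card_insert_le _ _)
      have hE1 : ¬ (S ≤ ρ ∧ 2 * Δ ≤ S + 2 * f) → E.card ≤ 1 := by
        intro hn
        refine Finset.card_le_one.2 fun a ha b hb => ?_
        simp only [E, Finset.mem_filter, Finset.mem_insert, Finset.mem_singleton] at ha hb
        omega
      by_cases h0 : f = 0
      · have := hE0 h0
        omega
      -- For `f > 0`, `small` gives `D.card + 1 ≤ f`, room for one forbidden weight. Both are within
      -- reach only if `2 * Δ - ρ ≤ 2 * f`, and then `D.card + 2 ≤ f`.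
      · by_cases hn : S ≤ ρ ∧ 2 * Δ ≤ S + 2 * f
        · omega
        · have := hE1 hn
          omega
    obtain ⟨c₂, hag₂, hle, hw, hc₂⟩ := hc₁.exists_insert hΔ hreg hv (hvn.mono hsub) _ hX
    rw [Finset.mem_union, not_or] at hw
    have hne : G.weight c₂ v ≠ ρ ∧ G.weight c₂ v ≠ 2 * Δ := by
      rcases Nat.eq_zero_or_pos f with h0 | h0
      · have hall : ∀ z, G.Adj v z → z ∈ F ∪ (D : Set V) := by
          intro z hz
          by_contra hzF
          exact Finset.notMem_empty z (Finset.card_eq_zero.1 h0 ▸ mem_nbrsOut.2 ⟨hz, hzF⟩)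
        rw [hag₂.weight_eq (Or.inr hall)]
        exact hc₁.weight_ne v (fun e => hvF (e ▸ hc.root_mem)) (Or.inr hall)
      · have h1 : G.weight c₂ v = S + ∑ x ∈ G.nbrsOut (F ∪ D) v, c₂ s(v, x) := by
          rw [weight_eq_add (F ∪ D), Finset.sum_congr rfl fun x hx => ?_]
          rw [Sym2.eq_swap, hag₂ x (mem_nbrsIn.1 hx).2]
        have h2 := Finset.sum_le_card_nsmul (G.nbrsOut (F ∪ D) v) (fun x => c₂ s(v, x)) 2
          fun x _ => hle _
        rw [smul_eq_mul] at h2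
        have h3 := hw.2
        simp only [E, Finset.mem_filter, Finset.mem_insert, Finset.mem_singleton] at h3
        constructor <;> intro h4 <;> exact h3 ⟨by tauto, by omega, by omega, h0⟩
    refine ⟨c₂, hag.trans hag₂ Set.subset_union_left, ?_, ?_⟩
    · have hDw : ∀ d ∈ D, G.weight c₂ d = G.weight c₁ d := fun d hd =>
        hag₂.weight_eq (Or.inl (Or.inr hd))
      rw [Finset.coe_insert, Set.injOn_insert (by simpa using hvD)]
      refine ⟨fun a ha b hb e => hinj ha hb (by rwa [← hDw a ha, ← hDw b hb]), ?_⟩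
      rintro ⟨d, hd, e⟩
      exact hw.1 (Finset.mem_image.2 ⟨d, hd, by rw [← hDw d hd, e]⟩)
    · rw [Finset.coe_insert, Set.union_insert]
      exact hc₂ hne.1 hne.2

/-- An automorphism preserves the weights if it preserves the colours. -/
theorem weight_map {c : Sym2 V → ℕ} {φ : G ≃g G}
    (hφ : ∀ x y, G.Adj x y → c s(φ x, φ y) = c s(x, y)) (v : V) :
    G.weight c (φ v) = G.weight c v := by
  refine (Finset.sum_equiv φ.toEquiv (fun x => ?_) fun x hx => ?_).symm
  · simpa using φ.map_adj_iff.symm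
  · exact (hφ v x (by simpa using hx)).symm

variable (G) in
/-- However the edges that do not meet `F` are coloured, every colour preserving automorphism
fixes all vertices of `F`, as long as no vertex other than `r` has weight `ρ`. -/
def Fixes (ρ : ℕ) (r : V) (F : Set V) (c : Sym2 V → ℕ) : Prop :=
  ∀ c' : Sym2 V → ℕ, AgreeOn F c c' → (∀ u, u ≠ r → G.weight c' u ≠ ρ) → ∀ φ : G ≃g G,
    (∀ x y, G.Adj x y → c' s(φ x, φ y) = c' s(x, y)) → ∀ x ∈ F, φ x = x

/-- Fixing `F` pointwise preserves traces, so `C` is mapped to itself. The weights on `C` are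
settled by edges meeting `F ∪ C`, so they survive later recolouring and tell the members apart. -/
theorem Fixes.union {ρ : ℕ} {r : V} {F : Set V} {c c' : Sym2 V → ℕ} (h : G.Fixes ρ r F c)
    (hag : AgreeOn F c c') (C : Set V)
    (hC : ∀ x ∈ C, ∀ y, y ∈ C ↔ y ∉ F ∧ G.trace F c y = G.trace F c x)
    (hinj : Set.InjOn (G.weight c') C) : G.Fixes ρ r (F ∪ C) c' := by
  intro c'' hag' hρ φ hφ x hx
  have hagF := hag.trans hag' Set.subset_union_left
  have hF := h c'' hagF hρ φ hφ
  rcases hx with hx | hx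
  · exact hF x hx
  have hxF := ((hC x hx x).1 hx).1
  have hφx : φ x ∈ C := by
    refine (hC x hx _).2 ⟨fun hmem => hxF ?_, ?_⟩
    · rwa [φ.injective (hF _ hmem)] at hmem
    · rw [← hagF.trace_eq, ← hagF.trace_eq, trace_eq_iff]
      intro w hw
      have h1 := φ.map_adj_iff (v := w) (w := x)
      have h2 := hφ w x
      rw [hF w hw] at h1 h2
      exact ⟨h1, h2⟩
  refine hinj hφx hx ?_
  rw [← hag'.weight_eq (Or.inl (Or.inr hφx)), ← hag'.weight_eq (Or.inl (Or.inr hx)),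
    weight_map hφ]

/-- The edges at the root can be coloured so as to start the construction. -/
theorem exists_isPartial_singleton {Δ : ℕ} (hΔ : 2 ≤ Δ) (hreg : G.IsRegularOfDegree Δ) (r : V) :
    ∃ c : Sym2 V → ℕ, G.IsPartial Δ (Δ / 2 + 2 * (Δ % 2)) r {r} c ∧
      G.Fixes (Δ / 2 + 2 * (Δ % 2)) r {r} c ∧ G.weight c r = Δ / 2 + 2 * (Δ % 2) := by
  classical
  set N := G.neighborFinset r with hN
  have hNc : N.card = Δ := hreg r
  -- Colours 0 and 1 get `Δ / 2` edges each, and colour 2 gets the odd edge, if any. This gives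
  -- weight `ρ`, and classes of size at most `Δ / 2`, as `small` requires with one neighbour in `F`.
  obtain ⟨A₀, hA₀, hA₀c⟩ := Finset.exists_subset_card_eq (s := N) (n := Δ / 2) (by omega)
  have hd := Finset.card_sdiff_of_subset hA₀
  obtain ⟨A₁, hA₁, hA₁c⟩ := Finset.exists_subset_card_eq (s := N \ A₀) (n := Δ / 2) (by omega)
  have hd' := Finset.card_sdiff_of_subset hA₁
  let h : V → ℕ := fun x => if x ∈ A₀ then 0 else if x ∈ A₁ then 1 else 2
  have hA₁h : ∀ x ∈ A₁, h x = 1 := fun x hx => by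
    have := (Finset.mem_sdiff.1 (hA₁ hx)).2
    simp [h, hx, this]
  have hA₂h : ∀ x ∈ (N \ A₀) \ A₁, h x = 2 := fun x hx => by
    simp only [Finset.mem_sdiff] at hx
    simp [h, hx]
  have hclass : ∀ k, (N.filter fun x => h x = k).card ≤ Δ / 2 := by
    intro k
    have hk : (N.filter fun x => h x = k) ⊆ A₀ ∨ (N.filter fun x => h x = k) ⊆ A₁ ∨
        (N.filter fun x => h x = k) ⊆ (N \ A₀) \ A₁ := by
      by_cases k0 : k = 0
      · left
        intro x hx
        simp only [Finset.mem_filter, h] at hx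
        split_ifs at hx <;> first | assumption | omega
      by_cases k1 : k = 1
      · right; left
        intro x hx
        simp only [Finset.mem_filter, h] at hx
        split_ifs at hx <;> first | assumption | omega
      · right; right
        intro x hx
        simp only [Finset.mem_filter, h] at hx
        simp only [Finset.mem_sdiff]
        split_ifs at hx <;> first | omega | tauto
    rcases hk with hk | hk | hk <;> have := Finset.card_le_card hk <;> omega
  obtain ⟨c, hcN, hc⟩ := exists_recolour (fun _ => 0) r N h
  have hw : G.weight c r = Δ / 2 + 2 * (Δ % 2) := by
    have h0 : ∑ x ∈ A₀, h x = 0 := Finset.sum_eq_zero fun x hx => by simp [h, hx]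
    rw [weight, ← hN, Finset.sum_congr rfl hcN, ← Finset.sum_sdiff hA₀, h0,
      ← Finset.sum_sdiff hA₁, Finset.sum_congr rfl hA₁h, Finset.sum_congr rfl hA₂h]
    simp only [Finset.sum_const, smul_eq_mul]
    omega
  have hin : ∀ x, G.Adj r x → G.nbrsIn {r} x = {r} := by
    intro x hx
    ext z
    simp only [mem_nbrsIn, Set.mem_singleton_iff, Finset.mem_singleton, and_iff_right_iff_imp]
    rintro rfl
    exact hx.symm
  refine ⟨c, ⟨rfl, ?_, ?_, ?_⟩, ?_, hw⟩
  · intro e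
    by_cases he : ∃ y ∈ N, e = s(r, y)
    · obtain ⟨y, hy, rfl⟩ := he
      rw [hcN y hy]
      simp only [h]
      split_ifs <;> omega
    · push Not at he
      rw [hc e he]; omega
  · rintro A x hxA hA ⟨z, hz⟩
    rw [mem_nbrsIn, Set.mem_singleton_iff] at hz
    obtain ⟨hz, rfl⟩ := hz
    right
    rw [hin x hz.symm, Finset.card_singleton]
    have hxN : x ∈ N := by simpa [hN] using hz.symm
    have : A.card ≤ Δ / 2 := by
      refine (Finset.card_le_card fun y hy => ?_).trans (hclass (h x))
      have h1 := trace_eq_iff.1 (hA y hy).2 z rfl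
      have hyN : y ∈ N := by simpa [hN] using h1.1.2 hz.symm
      have h2 := h1.2 hz.symm
      rw [hcN y hyN, hcN x hxN] at h2
      exact Finset.mem_filter.2 ⟨hyN, h2⟩
    omega
  · intro u hur hu
    exfalso
    rcases hu with hu | hu
    · exact hur hu
    · have h1 : G.neighborFinset u ⊆ {r} := fun z hz => by
        simpa using hu z (by simpa using hz)
      have h2 := Finset.card_le_card h1
      rw [card_neighborFinset_eq_degree, hreg u, Finset.card_singleton] at h2
      omega
  · intro c' hag hρ φ hφ x hx
    rw [Set.mem_singleton_iff] at hx
    subst hx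
    by_contra hne
    refine hρ _ hne ?_
    rw [weight_map hφ, hag.weight_eq (Or.inl rfl), hw]

/-- The union of a chain of partial colourings. -/
theorem exists_isPartial_sUnion {Δ ρ : ℕ} {r : V} (𝒞 : Set (Set V × (Sym2 V → ℕ)))
    (hne : 𝒞.Nonempty)
    (hchain : ∀ s ∈ 𝒞, ∀ t ∈ 𝒞, s.1 ⊆ t.1 ∧ AgreeOn s.1 s.2 t.2 ∨
      t.1 ⊆ s.1 ∧ AgreeOn t.1 t.2 s.2)
    (h𝒞 : ∀ s ∈ 𝒞, G.IsPartial Δ ρ r s.1 s.2 ∧ G.Fixes ρ r s.1 s.2 ∧ G.weight s.2 r = ρ) :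
    ∃ F c, (∀ s ∈ 𝒞, s.1 ⊆ F ∧ AgreeOn s.1 s.2 c) ∧
      G.IsPartial Δ ρ r F c ∧ G.Fixes ρ r F c ∧ G.weight c r = ρ := by
  classical
  obtain ⟨s₀, hs₀⟩ := hne
  -- Members of the chain that an edge meets agree on its colour; 0 is a filler for edges that meet
  -- none.
  let c : Sym2 V → ℕ := fun e => if H : ∃ s ∈ 𝒞, ∃ w ∈ s.1, w ∈ e then H.choose.2 e else 0
  have hc : ∀ s ∈ 𝒞, AgreeOn s.1 s.2 c := by
    intro s hs w hw x
    have H : ∃ t ∈ 𝒞, ∃ z ∈ t.1, z ∈ s(w, x) := ⟨s, hs, w, hw, Sym2.mem_mk_left w x⟩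
    refine (dif_pos H).trans ?_
    have hspec := H.choose_spec
    generalize H.choose = t at hspec ⊢
    obtain ⟨ht, z, hz, hze⟩ := hspec
    rcases hchain s hs _ ht with h | h
    · exact h.2 w hw x
    · obtain ⟨y, hy⟩ := hze
      rw [hy]
      exact (h.2 z hz y).symm
  let F : Set V := ⋃ s ∈ 𝒞, s.1
  have hsub : ∀ s ∈ 𝒞, s.1 ⊆ F := fun s hs => Set.subset_biUnion_of_mem (u := fun s => s.1) hs
  -- By local finiteness `small` and `weight_ne` involve finitely many vertices of `F` at a time, so
  -- a single member of the chain decides them.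
  have hfin : ∀ B : Finset V, (B : Set V) ⊆ F → ∃ s ∈ 𝒞, (B : Set V) ⊆ s.1 := by
    intro B
    induction B using Finset.induction_on with
    | empty => exact fun _ => ⟨s₀, hs₀, by simp⟩
    | insert b B _ ih =>
      intro hB
      rw [Finset.coe_insert, Set.insert_subset_iff] at hB
      obtain ⟨s, hs, hBs⟩ := ih hB.2
      obtain ⟨t, ht, hbt⟩ := Set.mem_iUnion₂.1 hB.1
      rcases hchain s hs t ht with h | h
      · exact ⟨t, ht, by
          rw [Finset.coe_insert, Set.insert_subset_iff]; exact ⟨hbt, hBs.trans h.1⟩⟩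
      · exact ⟨s, hs, by
          rw [Finset.coe_insert, Set.insert_subset_iff]; exact ⟨h.1 hbt, hBs⟩⟩
  have hr : ∀ s ∈ 𝒞, r ∈ s.1 := fun s hs => (h𝒞 s hs).1.root_mem
  refine ⟨F, c, fun s hs => ⟨hsub s hs, hc s hs⟩, ⟨hsub _ hs₀ (hr _ hs₀), ?_, ?_, ?_⟩, ?_, ?_⟩
  · intro e
    by_cases H : ∃ s ∈ 𝒞, ∃ w ∈ s.1, w ∈ e
    · refine (dif_pos H).trans_le ?_
      exact (h𝒞 _ H.choose_spec.1).1.le_two e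
    · exact (dif_neg H).trans_le (Nat.zero_le _)
  · intro A x hxA hA hxF
    obtain ⟨s, hs, hBs⟩ := hfin (G.nbrsIn F x) fun z hz => (mem_nbrsIn.1 hz).2
    have hnb : G.nbrsIn s.1 x = G.nbrsIn F x := by
      ext z
      simp only [mem_nbrsIn]
      exact ⟨fun h => ⟨h.1, hsub s hs h.2⟩, fun h => ⟨h.1, hBs (mem_nbrsIn.2 h)⟩⟩
    rw [← hnb] at hxF ⊢
    refine (h𝒞 s hs).1.small A x hxA (fun y hy => ⟨fun h => (hA y hy).1 (hsub s hs h), ?_⟩) hxF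
    rw [← (hc s hs).trace_eq, ← (hc s hs).trace_eq, trace_eq_iff]
    exact fun w hw => trace_eq_iff.1 (hA y hy).2 w (hsub s hs hw)
  · intro u hur hu
    obtain ⟨s, hs, hus⟩ : ∃ s ∈ 𝒞, u ∈ s.1 ∨ ∀ z, G.Adj u z → z ∈ s.1 := by
      rcases hu with hu | hu
      · obtain ⟨s, hs, h⟩ := Set.mem_iUnion₂.1 hu
        exact ⟨s, hs, Or.inl h⟩
      · obtain ⟨s, hs, h⟩ := hfin (G.neighborFinset u) fun z hz => hu z (by simpa using hz)
        exact ⟨s, hs, Or.inr fun z hz => h (by simpa using hz)⟩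
    rw [(hc s hs).weight_eq hus]
    exact (h𝒞 s hs).1.weight_ne u hur hus
  · intro c' hag hρ φ hφ x hx
    obtain ⟨s, hs, h⟩ := Set.mem_iUnion₂.1 hx
    exact (h𝒞 s hs).2.1 c' ((hc s hs).trans hag (hsub s hs)) hρ φ hφ x h
  · rw [(hc s₀ hs₀).weight_eq (Or.inl (hr s₀ hs₀))]
    exact (h𝒞 s₀ hs₀).2.2

/-- A connected `Δ`-regular graph, `2 ≤ Δ`, has a distinguishing colouring with the colours
`0`, `1`, `2` in which no vertex sees the colour `2` only. -/
theorem exists_distinguishing_weight_ne {Δ : ℕ} (hΔ : 2 ≤ Δ) (hconn : G.Connected)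
    (hreg : G.IsRegularOfDegree Δ) :
    ∃ c : Sym2 V → ℕ, (∀ e, c e ≤ 2) ∧ (∀ v, G.weight c v ≠ 2 * Δ) ∧
      ∀ φ : G ≃g G, (∀ x y, G.Adj x y → c s(φ x, φ y) = c s(x, y)) → ∀ x, φ x = x := by
  classical
  obtain ⟨r⟩ := hconn.nonempty
  set ρ := Δ / 2 + 2 * (Δ % 2) with hρ
  let T := {s : Set V × (Sym2 V → ℕ) //
    G.IsPartial Δ ρ r s.1 s.2 ∧ G.Fixes ρ r s.1 s.2 ∧ G.weight s.2 r = ρ}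
  let R : T → T → Prop := fun s t => s.1.1 ⊆ t.1.1 ∧ AgreeOn s.1.1 s.1.2 t.1.2
  obtain ⟨⟨⟨F, c⟩, hP, hFix, hr⟩, hmax⟩ : ∃ m : T, ∀ a, R m a → R a m := by
    refine exists_maximal_of_chains_bounded (r := R) (fun 𝒞 h𝒞 => ?_)
      fun h1 h2 => ⟨h1.1.trans h2.1, h1.2.trans h2.2 h1.1⟩
    rcases 𝒞.eq_empty_or_nonempty with rfl | hne
    · obtain ⟨c, hc⟩ := exists_isPartial_singleton hΔ hreg r
      exact ⟨⟨(_, c), hc⟩, by simp⟩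
    · obtain ⟨F, c, hub, hc⟩ := exists_isPartial_sUnion (G := G) (Δ := Δ) (ρ := ρ) (r := r)
        (Subtype.val '' 𝒞) (hne.image _) (by
          rintro _ ⟨s, hs, rfl⟩ _ ⟨t, ht, rfl⟩
          by_cases hst : s = t
          · subst hst; exact Or.inl ⟨subset_rfl, fun _ _ _ => rfl⟩
          · exact h𝒞 hs ht hst) (by
          rintro _ ⟨s, hs, rfl⟩
          exact s.2)
      exact ⟨⟨(F, c), hc⟩, fun s hs => hub _ ⟨s, hs, rfl⟩⟩
  have hF : ∀ x, x ∈ F := by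
    by_contra! hx
    obtain ⟨x, hx⟩ := hx
    obtain ⟨w, hw, v, hv, hwv⟩ : ∃ w ∈ F, ∃ v, v ∉ F ∧ G.Adj w v := by
      obtain ⟨p⟩ := hconn.preconnected r x
      obtain ⟨d, -, h1, h2⟩ := p.exists_boundary_dart F hP.root_mem hx
      exact ⟨d.fst, h1, d.snd, h2, d.adj⟩
    -- The whole class of `v` lies among the neighbours of `w`, hence is finite.
    set C : Finset V := (G.nbrsOut F w).filter fun y => G.trace F c y = G.trace F c v with hC
    have hmem : ∀ y, y ∈ C ↔ y ∉ F ∧ G.trace F c y = G.trace F c v := by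
      intro y
      rw [hC, Finset.mem_filter, mem_nbrsOut]
      refine ⟨fun h => ⟨h.1.2, h.2⟩, fun h => ⟨⟨?_, h.1⟩, h.2⟩⟩
      exact (trace_eq_iff.1 h.2 w hw).1.2 hwv
    obtain ⟨c', hag, hinj, hP'⟩ := hP.exists_union hΔ hreg C
      (fun x hx y hy => ((hmem y).1 hy).2.trans ((hmem x).1 hx).2.symm)
      (fun x hx => ⟨((hmem x).1 hx).1, w, mem_nbrsIn.2
        ⟨((trace_eq_iff.1 ((hmem x).1 hx).2 w hw).1.2 hwv).symm, hw⟩⟩)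
    have hFix' := hFix.union hag (C : Set V) (fun x hx y => by
      rw [Finset.mem_coe, hmem y, ((hmem x).1 hx).2]) hinj
    have hr' : G.weight c' r = ρ := by rw [hag.weight_eq (Or.inl hP.root_mem)]; exact hr
    have := hmax ⟨(F ∪ C, c'), hP', hFix', hr'⟩ ⟨Set.subset_union_left, hag⟩
    exact hv (this.1 (Or.inr ((hmem v).2 ⟨hv, rfl⟩)))
  have hwt := fun u (hu : u ≠ r) => hP.weight_ne u hu (Or.inl (hF u))
  refine ⟨c, hP.le_two, fun v => ?_, fun φ hφ x =>
    hFix c (fun _ _ _ => rfl) (fun u hu => (hwt u hu).1) φ hφ x (hF x)⟩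
  by_cases hvr : v = r
  · subst hvr
    have : G.weight c v = ρ := hr
    omega
  · exact (hwt v hvr).2

end

end SimpleGraph

/-! ### Small degrees and translation to edge labellings -/

namespace SimpleGraph

/-- A distinguishing colouring by `0`, `1`, `2` gives one by any three colours. -/
theorem isDistinguishing_comp {V C : Type*} {G : SimpleGraph V} {c : Sym2 V → ℕ}
    (hc : ∀ e, c e ≤ 2)
    (h : ∀ φ : G ≃g G, (∀ x y, G.Adj x y → c s(φ x, φ y) = c s(x, y)) → ∀ x, φ x = x)
    (f : ℕ → C) (hf : Set.InjOn f {k | k ≤ 2}) :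
    IsDistinguishing (G := G) (fun e : G.edgeSet => f (c e) : G.EdgeLabeling C) := by
  intro φ hφ
  ext x
  exact h φ (fun x y hxy => hf (hc _) (hc _) (hφ ⟨s(x, y), hxy⟩)) x

theorem IsDistinguishing.of_subsingleton {V C : Type*} [Subsingleton V] {G : SimpleGraph V}
    (c : G.EdgeLabeling C) : IsDistinguishing c := fun φ _ => by
  ext x
  exact Subsingleton.elim _ _

theorem distinguishingIndex_le {V : Type*} {G : SimpleGraph V} {n : ℕ}
    (c : G.EdgeLabeling (Fin n)) (hc : IsDistinguishing c) : G.distinguishingIndex ≤ n :=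
  sInf_le ⟨n, rfl, c, hc⟩

theorem subsingleton_of_isRegularOfDegree_zero {V : Type*} {G : SimpleGraph V} [G.LocallyFinite]
    (hconn : G.Connected) (hreg : G.IsRegularOfDegree 0) : Subsingleton V := by
  by_contra h
  rw [not_subsingleton_iff_nontrivial] at h
  obtain ⟨r⟩ := hconn.nonempty
  obtain ⟨w, hw⟩ := hconn.preconnected.exists_adj_of_nontrivial r
  have := (G.degree_pos_iff_exists_adj r).2 ⟨w, hw⟩
  have := hreg r
  omega

/-- `K₂` is the only connected `1`-regular graph. -/
theorem nonempty_iso_of_isRegularOfDegree_one {V : Type*} {G : SimpleGraph V} [G.LocallyFinite]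
    (hconn : G.Connected) (hreg : G.IsRegularOfDegree 1) :
    Nonempty (G ≃g completeGraph (Fin 2)) := by
  classical
  obtain ⟨r⟩ := hconn.nonempty
  have huniq : ∀ x y z, G.Adj x y → G.Adj x z → y = z := by
    intro x y z hy hz
    have h := hreg x
    rw [← card_neighborFinset_eq_degree] at h
    exact Finset.card_le_one.1 h.le y (by simpa using hy) z (by simpa using hz)
  obtain ⟨w, hw⟩ := (G.degree_pos_iff_exists_adj r).1 (by rw [hreg r]; exact one_pos)
  have hall : ∀ x, x = r ∨ x = w := by
    by_contra! hx
    obtain ⟨x, hx⟩ := hx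
    obtain ⟨p⟩ := hconn.preconnected r x
    obtain ⟨d, -, h1, h2⟩ := p.exists_boundary_dart {r, w} (by simp) (by simpa using hx)
    rcases h1 with h1 | h1
    · exact h2 (Or.inr (huniq r _ _ (h1 ▸ d.adj) hw))
    · exact h2 (Or.inl (huniq w _ _ (h1 ▸ d.adj) hw.symm))
  refine ⟨⟨⟨fun x => if x = r then 0 else 1, fun i => if i = 0 then r else w, ?_, ?_⟩, ?_⟩⟩
  · intro x
    rcases hall x with rfl | rfl
    · simp
    · simp [hw.ne']
  · intro i
    fin_cases i
    · simp
    · simp [hw.ne']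
  · intro x y
    rcases hall x with rfl | rfl <;> rcases hall y with rfl | rfl <;>
      simp [hw.ne', hw, hw.symm]

/-- The colours red, green and blue, numbered from `0` to `2`. -/
def RGB.ofNat : ℕ → RGB
  | 0 => RGB.red
  | 1 => RGB.green
  | _ => RGB.blue

theorem RGB.ofNat_injOn : Set.InjOn RGB.ofNat {k | k ≤ 2} := by
  intro i hi j hj h
  rw [Set.mem_ofPred_eq] at hi hj
  interval_cases i <;> interval_cases j <;> first | rfl | exact absurd h (by simp [RGB.ofNat])

end SimpleGraph

theorem mainTheorem1 {V : Type*} (G : SimpleGraph V) [G.LocallyFinite] (Δ : ℕ)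
    (hconn : G.Connected) (hreg : G.IsRegularOfDegree Δ) :
    (Δ ≠ 1 → G.distinguishingIndex ≤ 3) ∧
    (¬ Nonempty (G ≃g SimpleGraph.completeGraph (Fin 2)) →
      ∃ c : G.EdgeLabeling SimpleGraph.RGB,
        SimpleGraph.IsDistinguishing c ∧
        (∀ v w : V, SimpleGraph.IsAllBlue c v → SimpleGraph.IsAllBlue c w → v = w) ∧
        (G = SimpleGraph.completeGraph V → Nontrivial V →
          ∀ v : V, ¬ SimpleGraph.IsAllBlue c v)) := by
  obtain rfl | rfl | hΔ : Δ = 0 ∨ Δ = 1 ∨ 2 ≤ Δ := by omega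
  -- A lone vertex is vacuously all blue: this is the exceptional vertex that the statement permits.
  · have := SimpleGraph.subsingleton_of_isRegularOfDegree_zero hconn hreg
    exact ⟨fun _ => SimpleGraph.distinguishingIndex_le (n := 3) (fun _ => 0) (.of_subsingleton _),
      fun _ => ⟨fun _ => .red, .of_subsingleton _, fun v w _ _ => Subsingleton.elim v w,
        fun _ h => absurd this (not_subsingleton_iff_nontrivial.2 h)⟩⟩
  · exact ⟨fun h => absurd rfl h,
      fun h => absurd (SimpleGraph.nonempty_iso_of_isRegularOfDegree_one hconn hreg) h⟩
  · obtain ⟨c, hc, hw, hfix⟩ := SimpleGraph.exists_distinguishing_weight_ne hΔ hconn hreg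
    refine ⟨fun _ => SimpleGraph.distinguishingIndex_le (n := 3) _
      (SimpleGraph.isDistinguishing_comp hc hfix (Fin.ofNat 3) ?_), fun _ => ⟨_,
      SimpleGraph.isDistinguishing_comp hc hfix _ SimpleGraph.RGB.ofNat_injOn, ?_⟩⟩
    · intro i hi j hj h
      rw [Set.mem_ofPred_eq] at hi hj
      have := congrArg Fin.val h
      simp only [Fin.val_ofNat] at this
      omega
    -- An all blue vertex would have weight `2 * Δ`.
    · have hblue : ∀ v, ¬ SimpleGraph.IsAllBlue (G := G)
          (fun e : G.edgeSet => SimpleGraph.RGB.ofNat (c e)) v := by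
        intro v hv
        refine hw v ?_
        have : ∀ x ∈ G.neighborFinset v, c s(v, x) = 2 := by
          intro x hx
          have hvx : s(v, x) ∈ G.edgeSet := by simpa using hx
          exact SimpleGraph.RGB.ofNat_injOn (hc _) (le_refl 2)
            (hv ⟨s(v, x), hvx⟩ (Sym2.mem_mk_left v x))
        rw [SimpleGraph.weight, Finset.sum_congr rfl this, Finset.sum_const,
          SimpleGraph.card_neighborFinset_eq_degree, hreg v, smul_eq_mul, mul_comm]
      exact ⟨fun v _ hv => absurd hv (hblue v), fun _ _ => hblue⟩
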